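/- Let $0<\epsilon\le 1$ and let $d$ be a positive integer with $d\ge 10/\epsilon$. Let $n$ and $d_A$ be integers obtained by rounding (up or down) $$\frac{120\ln 2}{\epsilon^3}\,d\log_2 d\qquad\text{and}\qquad \frac{112\ln 2}{\epsilon^2}\,d\log_2 d ,$$ respectively, and let $\mathcal H_A=\mathbb C^{d_A}$, $\mathcal H_B=\mathbb C^{d}$. Then there exist linear isometries $U_1,\dots,U_n:\mathbb C^{d^2}\to\mathcal H_A\otimes\mathcal H_B$ such that for every unit vector $|\psi\rangle\in\mathbb C^{d^2}$ $$\frac1n\,\#\Bigl\{k\in\{1,\dots,n\} : \bigl\|\operatorname{Tr}_A U_k|\psi\rangle\langle\psi|U_k^\dagger\bigr\|_\infty<\frac{1+\epsilon}{d}\Bigr\}\;\ge\;1-\epsilon ,$$ where $\operatorname{Tr}_A$ is the partial trace over $\mathcal H_A$ and $\|\cdot\|_\infty$ is the operator norm. The isometries do not depend on $\psi$. -/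

import Mathlib

noncomputable section

/-- The pure state `|ψ⟩⟨ψ|` of a vector `ψ`, as an operator. -/
def pureState {ι : Type*} [Fintype ι] (ψ : EuclideanSpace ℂ ι) :
    EuclideanSpace ℂ ι →L[ℂ] EuclideanSpace ℂ ι :=
  InnerProductSpace.rankOne ℂ ψ ψ

/-- The partial trace `Tr_A T` of an operator `T` on `ℂ^a ⊗ ℂ^b`. The tensor product is realised as
`ℂ^(a × b)`, the standard basis vector at `(i, j)` being `|i⟩_A |j⟩_B`. The operator `Tr_A T` on
`ℂ^b` has the matrix entries `⟨j| Tr_A T |j'⟩ = ∑ i, ⟨i j| T |i j'⟩`. -/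
def partialTraceA {a b : Type*} [Fintype a] [Fintype b] [DecidableEq a] [DecidableEq b]
    (T : EuclideanSpace ℂ (a × b) →L[ℂ] EuclideanSpace ℂ (a × b)) :
    EuclideanSpace ℂ b →L[ℂ] EuclideanSpace ℂ b :=
  Matrix.toEuclideanCLM (𝕜 := ℂ)
    (Matrix.of fun j j' : b => ∑ i : a, T (EuclideanSpace.single (i, j') 1) (i, j))

/-- The conjugation `U T U†` of an operator `T` by an isometry `U`. -/
def conjIsometry {ι κ : Type*} [Fintype ι] [Fintype κ]
    (U : EuclideanSpace ℂ ι →ₗᵢ[ℂ] EuclideanSpace ℂ κ)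
    (T : EuclideanSpace ℂ ι →L[ℂ] EuclideanSpace ℂ ι) :
    EuclideanSpace ℂ κ →L[ℂ] EuclideanSpace ℂ κ :=
  U.toContinuousLinearMap ∘L T ∘L ContinuousLinearMap.adjoint U.toContinuousLinearMap

end

/-!
For a unit vector `y` of `ℂ^a ⊗ ℂ^b`, the norm of `Tr_A |y⟩⟨y|` is the largest squared length
`‖⟨φ|y⟩‖²` over unit vectors `φ` of `ℂ^b`. If `y = U x` for a Haar distributed unitary `U`, then
`y` has the law of a normalised Gaussian vector and `‖⟨φ|y⟩‖²` is the squared length of its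
projection onto `dim a` of the `dim a * dim b` coordinates. A Chernoff bound and a net of vectors
`φ` show that it exceeds `(1 + ε / 2) / dim b` for some `φ` in the net with probability at most
`1 / M`, where `M = (dim b) ^ (2 * dim b)`.

For `n` independent unitaries and a fixed `x`, let `c` be the number of those for which this
happens. Then the expectation of `M ^ c` is at most `2 ^ n`. Summing over a net of vectors `x`, some
choice of unitaries bounds `M ^ c` for all of them at once, and taking logarithms gives `c ≤ ε * n`.
The Lipschitz continuity of `‖⟨φ|y⟩‖` in `y` extends this from the net to all unit vectors.
-/

open MeasureTheory Set Module
open scoped ENNReal NNReal InnerProductSpace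

section UnitaryOrbit

variable {𝕜 E : Type*} [RCLike 𝕜] [NormedAddCommGroup E] [InnerProductSpace 𝕜 E]
  [FiniteDimensional 𝕜 E]

theorem exists_orthonormalBasis_apply_eq {ι : Type*} [Fintype ι]
    (hι : finrank 𝕜 E = Fintype.card ι) (i : ι) {u : E} (hu : ‖u‖ = 1) :
    ∃ B : OrthonormalBasis ι 𝕜 E, B i = u := by
  have hon : Orthonormal 𝕜 (({i} : Set ι).domRestrict fun _ => u) :=
    ⟨fun _ => hu, fun j k hjk => absurd (Subsingleton.elim j k) hjk⟩
  obtain ⟨B, hB⟩ := hon.exists_orthonormalBasis_extension_of_card_eq hι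
  exact ⟨B, hB i rfl⟩

theorem exists_linearIsometryEquiv_apply_eq {x y : E} (h : ‖x‖ = ‖y‖) :
    ∃ L : E ≃ₗᵢ[𝕜] E, L x = y := by
  rcases eq_or_ne x 0 with rfl | hx
  · exact ⟨.refl 𝕜 E, by simpa [eq_comm] using h⟩
  have hy : y ≠ 0 := by rwa [← norm_ne_zero_iff, ← h, norm_ne_zero_iff]
  have hcard : finrank 𝕜 E = Fintype.card (Fin (finrank 𝕜 E)) := by simp
  have : Nontrivial E := ⟨x, 0, hx⟩
  let i : Fin (finrank 𝕜 E) := ⟨0, finrank_pos⟩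
  obtain ⟨B, hB⟩ := exists_orthonormalBasis_apply_eq hcard i (norm_smul_inv_norm (𝕜 := 𝕜) hx)
  obtain ⟨C, hC⟩ := exists_orthonormalBasis_apply_eq hcard i (norm_smul_inv_norm (𝕜 := 𝕜) hy)
  have hx' : ((‖x‖ : 𝕜)⁻¹) ≠ 0 := by simpa using hx
  refine ⟨B.equiv C (Equiv.refl _), smul_right_injective E hx' ?_⟩
  dsimp only
  rw [← map_smul, ← hB, OrthonormalBasis.equiv_apply_basis, Equiv.refl_apply, hC, h]

end UnitaryOrbit

section HaarUnitary

variable {E : Type*} [NormedAddCommGroup E] [InnerProductSpace ℂ E] [FiniteDimensional ℂ E]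

instance compactSpace_unitary : CompactSpace (unitary (E →L[ℂ] E)) := by
  have hbdd : (unitary (E →L[ℂ] E) : Set (E →L[ℂ] E)) ⊆ Metric.closedBall 0 1 := fun U hU => by
    rw [mem_closedBall_zero_iff]
    exact U.opNorm_le_bound zero_le_one fun x =>
      ((Unitary.linearIsometryEquiv ⟨U, hU⟩).norm_map x).le.trans_eq (one_mul _).symm
  have : ProperSpace (E →L[ℂ] E) := FiniteDimensional.proper ℂ _
  exact isCompact_iff_compactSpace.1 <|
    Metric.isCompact_of_isClosed_isBounded isClosed_unitary
      (Metric.isBounded_closedBall.subset hbdd)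

variable (E) in
/-- The Haar probability measure on the unitary group of `E`. Mathlib's Haar measure is left
invariant; its image under inversion is used because right invariance is what makes the law of
`U x` depend on `‖x‖` only. -/
noncomputable def haarUnitary : Measure (unitary (E →L[ℂ] E)) := (Measure.haarMeasure ⊤).inv

instance isProbabilityMeasure_haarUnitary : IsProbabilityMeasure (haarUnitary E) := by
  have : IsProbabilityMeasure (Measure.haarMeasure (⊤ : TopologicalSpace.PositiveCompacts
      (unitary (E →L[ℂ] E)))) := ⟨Measure.haarMeasure_self⟩
  exact Measure.isProbabilityMeasure_map measurable_inv.aemeasurable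

instance isMulRightInvariant_haarUnitary : (haarUnitary E).IsMulRightInvariant :=
  Measure.inv.instIsMulRightInvariant

theorem continuous_unitary_apply : Continuous fun p : unitary (E →L[ℂ] E) × E => p.1.1 p.2 :=
  (continuous_subtype_val.comp continuous_fst).clm_apply continuous_snd

variable [MeasurableSpace E] [BorelSpace E] {S : Set E}

theorem haarUnitary_apply_mem_congr (hS : MeasurableSet S)
    (hcone : ∀ (c : ℂ) (y : E), c ≠ 0 → (c • y ∈ S ↔ y ∈ S)) {x y : E} (hx : x ≠ 0) (hy : y ≠ 0) :
    haarUnitary E {U | U.1 x ∈ S} = haarUnitary E {U | U.1 y ∈ S} := by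
  have hc : (‖y‖ : ℂ) * (‖x‖ : ℂ)⁻¹ ≠ 0 := by simp [hx, hy]
  obtain ⟨L, hL⟩ := exists_linearIsometryEquiv_apply_eq (𝕜 := ℂ)
    (x := ((‖y‖ : ℂ) * (‖x‖ : ℂ)⁻¹) • x) (y := y) (by simp [norm_smul, hx])
  let V : unitary (E →L[ℂ] E) := Unitary.linearIsometryEquiv.symm L
  have hslice : MeasurableSet {U : unitary (E →L[ℂ] E) | U.1 x ∈ S} :=
    measurable_prodMk_right (continuous_unitary_apply.measurable hS)
  rw [← (measurePreserving_mul_right (haarUnitary E) V).measure_preimage hslice.nullMeasurableSet]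
  congr 1
  ext U
  have hVx : V.1 x = L x := rfl
  simp only [mem_ofPred_eq, mem_preimage, Submonoid.coe_mul, mul_apply_eq_comp, hVx]
  rw [← hL, map_smul, map_smul, hcone _ _ hc]

theorem haarUnitary_apply_mem_mul_measure_univ {μ : Measure E} [SFinite μ] [NullSingletonClass μ]
    (hμ : ∀ L : E ≃ₗᵢ[ℂ] E, MeasurePreserving L μ μ) (hS : MeasurableSet S)
    (hcone : ∀ (c : ℂ) (y : E), c ≠ 0 → (c • y ∈ S ↔ y ∈ S)) {x : E} (hx : x ≠ 0) :
    haarUnitary E {U | U.1 x ∈ S} * μ univ = μ S := by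
  have hmeas : MeasurableSet {p : unitary (E →L[ℂ] E) × E | p.1.1 p.2 ∈ S} :=
    continuous_unitary_apply.measurable hS
  have hne : ∀ᵐ y ∂μ, y ≠ 0 := compl_mem_ae_iff.2 (measure_singleton 0)
  calc haarUnitary E {U | U.1 x ∈ S} * μ univ
      = ∫⁻ y, haarUnitary E {U | U.1 y ∈ S} ∂μ := by
        rw [← lintegral_const]
        exact lintegral_congr_ae (hne.mono fun y hy => haarUnitary_apply_mem_congr hS hcone hx hy)
    _ = (haarUnitary E).prod μ {p | p.1.1 p.2 ∈ S} := (Measure.prod_apply_symm hmeas).symm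
    _ = ∫⁻ U, μ (U.1 ⁻¹' S) ∂haarUnitary E := Measure.prod_apply hmeas
    _ = ∫⁻ _U, μ S ∂haarUnitary E := lintegral_congr fun U =>
        (hμ (Unitary.linearIsometryEquiv U)).measure_preimage hS.nullMeasurableSet
    _ = μ S := by simp

end HaarUnitary

section Gaussian

theorem measurePreserving_linearIsometryEquiv {E : Type*} [NormedAddCommGroup E]
    [NormedSpace ℂ E] [FiniteDimensional ℂ E] [MeasurableSpace E] [BorelSpace E]
    (ν : Measure E) [ν.IsAddHaarMeasure] (L : E ≃ₗᵢ[ℂ] E) : MeasurePreserving L ν ν := by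
  have : ProperSpace E := FiniteDimensional.proper ℂ E
  have : (ν.map L).IsAddHaarMeasure := L.toContinuousLinearEquiv.isAddHaarMeasure_map ν
  let K : TopologicalSpace.PositiveCompacts E :=
    ⟨⟨Metric.closedBall 0 1, isCompact_closedBall 0 1⟩,
      ⟨0, Metric.ball_subset_interior_closedBall (Metric.mem_ball_self one_pos)⟩⟩
  have hK : ν.map L K = ν K := by
    have hball : L ⁻¹' Metric.closedBall 0 1 = Metric.closedBall 0 1 := by ext; simp
    rw [Measure.map_apply L.continuous.measurable K.isCompact.measurableSet]
    exact congrArg ν hball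
  refine ⟨L.continuous.measurable, ?_⟩
  rw [Measure.addHaarMeasure_unique (ν.map L) K, hK, ← Measure.addHaarMeasure_unique]

theorem lintegral_exp_neg_sum_mul_sq_norm {ι : Type*} [Fintype ι] {b : ι → ℝ}
    (hb : ∀ i, 0 < b i) :
    ∫⁻ z : ι → ℂ, ENNReal.ofReal (Real.exp (-∑ i, b i * ‖z i‖ ^ 2))
      = ENNReal.ofReal (∏ i, Real.pi / b i) := by
  have hone : ∀ i, ∫ z : ℂ, Real.exp (-b i * ‖z‖ ^ 2) = Real.pi / b i := fun i => by
    rw [GaussianFourier.integral_rexp_neg_mul_sq_norm (hb i), Complex.finrank_real_complex]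
    norm_num
  have hint : ∀ i, Integrable fun z : ℂ => Real.exp (-b i * ‖z‖ ^ 2) := fun i => by
    refine Integrable.of_integral_ne_zero ?_
    rw [hone]
    exact (div_pos Real.pi_pos (hb i)).ne'
  have hprod : ∀ z : ι → ℂ, Real.exp (-∑ i, b i * ‖z i‖ ^ 2) = ∏ i, Real.exp (-b i * ‖z i‖ ^ 2) :=
    fun z => by simp only [← Real.exp_sum, neg_mul, Finset.sum_neg_distrib]
  have hint' : Integrable fun z : ι → ℂ => ∏ i, Real.exp (-b i * ‖z i‖ ^ 2) :=
    Integrable.fintype_prod hint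
  simp_rw [hprod]
  rw [← ofReal_integral_eq_lintegral_ofReal hint' (.of_forall fun z => by positivity),
    integral_fintype_prod_volume_eq_prod fun i (z : ℂ) => Real.exp (-b i * ‖z‖ ^ 2)]
  simp_rw [hone]

/-- Lebesgue measure on `ℂ^ι`, as the image of the product measure on `ι → ℂ`, so that Gaussian
integrals factor over the coordinates. -/
noncomputable def complexVolume (ι : Type*) [Fintype ι] : Measure (EuclideanSpace ℂ ι) :=
  (volume : Measure (ι → ℂ)).map (EuclideanSpace.equiv ι ℂ).symm

instance isAddHaarMeasure_complexVolume (ι : Type*) [Fintype ι] :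
    (complexVolume ι).IsAddHaarMeasure :=
  (EuclideanSpace.equiv ι ℂ).symm.isAddHaarMeasure_map volume

/-- The rotation-invariant Gaussian measure with density `exp (-‖y‖²)` on `ℂ^ι`. It is not
normalised: its total mass is `π ^ card ι`. -/
noncomputable def gaussianMeasure (ι : Type*) [Fintype ι] : Measure (EuclideanSpace ℂ ι) :=
  (complexVolume ι).withDensity fun y => ENNReal.ofReal (Real.exp (-‖y‖ ^ 2))

variable {ι : Type*} [Fintype ι]

instance sFinite_gaussianMeasure : SFinite (gaussianMeasure ι) := by
  unfold gaussianMeasure; infer_instance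

instance nullSingletonClass_gaussianMeasure [Nonempty ι] :
    NullSingletonClass (gaussianMeasure ι) := by
  have := Module.punctured_nhds_neBot ℂ (EuclideanSpace ℂ ι) 0
  unfold gaussianMeasure; infer_instance

theorem gaussianMeasure_univ :
    gaussianMeasure ι univ = ENNReal.ofReal (Real.pi ^ Fintype.card ι) := by
  have h := lintegral_exp_neg_sum_mul_sq_norm (ι := ι) fun _ => one_pos
  simp only [one_mul, div_one, Finset.prod_const, Finset.card_univ] at h
  rw [gaussianMeasure, withDensity_apply _ .univ, Measure.restrict_univ, complexVolume,
    lintegral_map (by fun_prop) (by fun_prop), ← h]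
  simp [EuclideanSpace.norm_sq_eq]

theorem measurePreserving_gaussianMeasure (L : EuclideanSpace ℂ ι ≃ₗᵢ[ℂ] EuclideanSpace ℂ ι) :
    MeasurePreserving L (gaussianMeasure ι) (gaussianMeasure ι) := by
  refine ⟨L.continuous.measurable, Measure.ext fun S hS => ?_⟩
  have h := (measurePreserving_linearIsometryEquiv (complexVolume ι) L).setLIntegral_comp_preimage
    hS (f := fun y => ENNReal.ofReal (Real.exp (-‖y‖ ^ 2))) (by fun_prop)
  rw [Measure.map_apply L.continuous.measurable hS, gaussianMeasure,
    withDensity_apply _ (L.continuous.measurable hS), withDensity_apply _ hS, ← h]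
  simp only [L.norm_map]

theorem gaussianMeasure_sum_mul_sq_norm_le_le {w : ι → ℝ} (hw : ∀ i, 0 < w i) :
    gaussianMeasure ι {y | ∑ i, w i * ‖y i‖ ^ 2 ≤ ‖y‖ ^ 2}
      ≤ ENNReal.ofReal (∏ i, (w i)⁻¹) * gaussianMeasure ι univ := by
  have hS : MeasurableSet {y : EuclideanSpace ℂ ι | ∑ i, w i * ‖y i‖ ^ 2 ≤ ‖y‖ ^ 2} :=
    (isClosed_le (by fun_prop) (by fun_prop)).measurableSet
  calc gaussianMeasure ι {y | ∑ i, w i * ‖y i‖ ^ 2 ≤ ‖y‖ ^ 2}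
      ≤ ∫⁻ y in {y | ∑ i, w i * ‖y i‖ ^ 2 ≤ ‖y‖ ^ 2},
          ENNReal.ofReal (Real.exp (-∑ i, w i * ‖y i‖ ^ 2)) ∂complexVolume ι := by
        rw [gaussianMeasure, withDensity_apply _ hS]
        exact setLIntegral_mono (by fun_prop) fun y hy =>
          ENNReal.ofReal_le_ofReal (Real.exp_le_exp.2 (neg_le_neg hy))
    _ ≤ ∫⁻ y, ENNReal.ofReal (Real.exp (-∑ i, w i * ‖y i‖ ^ 2)) ∂complexVolume ι :=
        setLIntegral_le_lintegral _ _
    _ = ENNReal.ofReal (∏ i, Real.pi / w i) := by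
        rw [complexVolume, lintegral_map (by fun_prop) (by fun_prop)]
        exact lintegral_exp_neg_sum_mul_sq_norm hw
    _ = ENNReal.ofReal (∏ i, (w i)⁻¹) * gaussianMeasure ι univ := by
        rw [gaussianMeasure_univ, ← ENNReal.ofReal_mul (Finset.prod_nonneg fun i _ =>
          (inv_pos.2 (hw i)).le)]
        simp only [div_eq_inv_mul, Finset.prod_mul_distrib, Finset.prod_const, Finset.card_univ]

end Gaussian

section Concentration

variable {ι : Type*} [Fintype ι] (s : Finset ι) {α β q δ : ℝ}

theorem gaussianMeasure_mul_sq_norm_le_sum_le (hα : 0 < α) (hαβ : α ≤ β)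
    (hq : β - 1 ≤ (β - α) * q) :
    gaussianMeasure ι {y | q * ‖y‖ ^ 2 ≤ ∑ i ∈ s, ‖y i‖ ^ 2}
      ≤ ENNReal.ofReal (α⁻¹ ^ s.card * β⁻¹ ^ (Fintype.card ι - s.card))
        * gaussianMeasure ι univ := by
  classical
  have hβ : 0 < β := hα.trans_le hαβ
  let w : ι → ℝ := fun i => if i ∈ s then α else β
  have hw : ∀ i, 0 < w i := fun i => by
    dsimp only [w]
    split_ifs <;> assumption
  have hprod : ∏ i, (w i)⁻¹ = α⁻¹ ^ s.card * β⁻¹ ^ (Fintype.card ι - s.card) := by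
    simp only [w, apply_ite (·⁻¹), Finset.prod_ite, Finset.prod_const, Finset.filter_univ_mem,
      Finset.filter_not, Finset.card_univ_sdiff]
  have hsum : ∀ y : EuclideanSpace ℂ ι, ∑ i, w i * ‖y i‖ ^ 2
      = β * ‖y‖ ^ 2 - (β - α) * ∑ i ∈ s, ‖y i‖ ^ 2 := fun y => by
    have hi : ∀ i, w i * ‖y i‖ ^ 2
        = β * ‖y i‖ ^ 2 - (β - α) * if i ∈ s then ‖y i‖ ^ 2 else 0 := fun i => by
      dsimp only [w]
      split_ifs <;> ring
    simp only [hi, Finset.sum_sub_distrib, ← Finset.mul_sum, EuclideanSpace.norm_sq_eq,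
      Finset.sum_ite_mem, Finset.univ_inter]
  rw [← hprod]
  refine (measure_mono fun y hy => ?_).trans (gaussianMeasure_sum_mul_sq_norm_le_le hw)
  have hβα := mul_le_mul_of_nonneg_left (mem_ofPred_eq ▸ hy) (sub_nonneg.2 hαβ)
  have hqy := mul_le_mul_of_nonneg_right hq (sq_nonneg ‖y‖)
  rw [mem_ofPred_eq, hsum]
  linarith

theorem gaussianMeasure_card_div_mul_sq_norm_le_sum_le (hδ : 0 ≤ δ)
    (hs : (1 + δ) * s.card < Fintype.card ι) :
    gaussianMeasure ι {y | (1 + δ) * (s.card / Fintype.card ι) * ‖y‖ ^ 2 ≤ ∑ i ∈ s, ‖y i‖ ^ 2}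
      ≤ ENNReal.ofReal (((1 + δ) * Real.exp (-δ)) ^ s.card) * gaussianMeasure ι univ := by
  have hcast : ((Fintype.card ι - s.card : ℕ) : ℝ) = Fintype.card ι - s.card :=
    Nat.cast_sub s.card_le_univ
  set D : ℝ := (Fintype.card ι : ℝ)
  set k : ℝ := (s.card : ℝ)
  have hk : 0 ≤ k := Nat.cast_nonneg _
  have hkD : δ * k < D - k := by linarith
  have hDk : 0 < D - k := (mul_nonneg hδ hk).trans_lt hkD
  have hD : 0 < D := by linarith
  have hgap : 0 < D - k - δ * k := sub_pos.2 hkD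
  -- The weights that minimise the Chernoff exponent.
  have hαβ : (1 + δ)⁻¹ ≤ (D - k) / (D - k - δ * k) := by
    refine (inv_le_one_of_one_le₀ (by linarith)).trans ((one_le_div hgap).2 ?_)
    exact sub_le_self _ (by positivity)
  have hq : (D - k) / (D - k - δ * k) - 1
      = ((D - k) / (D - k - δ * k) - (1 + δ)⁻¹) * ((1 + δ) * (k / D)) := by
    generalize hg : D - k - δ * k = g at hgap
    field_simp
    rw [← hg]
    ring
  have hpow : ((D - k) / (D - k - δ * k))⁻¹ ^ (Fintype.card ι - s.card)
      ≤ Real.exp (-δ) ^ s.card := by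
    rw [inv_div, sub_div, div_self hDk.ne', ← hcast, ← Real.exp_nat_mul, mul_neg, mul_comm _ δ]
    exact Real.one_sub_div_pow_le_exp_neg (by rw [hcast]; exact hkD.le)
  refine (gaussianMeasure_mul_sq_norm_le_sum_le s (by positivity) hαβ hq.le).trans ?_
  rw [inv_inv, mul_pow]
  gcongr

theorem haarUnitary_mul_sq_norm_le_sum_le (hδ : 0 ≤ δ) (hs : (1 + δ) * s.card < Fintype.card ι)
    (B : OrthonormalBasis ι ℂ (EuclideanSpace ℂ ι)) {x : EuclideanSpace ℂ ι} (hx : x ≠ 0) :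
    haarUnitary (EuclideanSpace ℂ ι) {U | (1 + δ) * (s.card / Fintype.card ι) * ‖x‖ ^ 2
        ≤ ∑ i ∈ s, ‖B.repr (U.1 x) i‖ ^ 2}
      ≤ ENNReal.ofReal (((1 + δ) * Real.exp (-δ)) ^ s.card) := by
  set q := (1 + δ) * (s.card / Fintype.card ι : ℝ)
  let S : Set (EuclideanSpace ℂ ι) := {y | q * ‖y‖ ^ 2 ≤ ∑ i ∈ s, ‖y i‖ ^ 2}
  have : Nonempty ι := not_isEmpty_iff.1 fun _ => hx (Subsingleton.elim x 0)
  have hS : MeasurableSet S := (isClosed_le (by fun_prop) (by fun_prop)).measurableSet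
  have hcone : ∀ (c : ℂ) (y : EuclideanSpace ℂ ι), c ≠ 0 →
      (c • y ∈ B.repr ⁻¹' S ↔ y ∈ B.repr ⁻¹' S) :=
    fun c y hc => by
      have hc' : 0 < ‖c‖ ^ 2 := by positivity
      simp only [S, mem_preimage, map_smul, mem_ofPred_eq, norm_smul, PiLp.smul_apply, mul_pow,
        ← Finset.mul_sum, mul_left_comm q, mul_le_mul_iff_right₀ hc']
  have hevent : {U : unitary (EuclideanSpace ℂ ι →L[ℂ] EuclideanSpace ℂ ι) |
      q * ‖x‖ ^ 2 ≤ ∑ i ∈ s, ‖B.repr (U.1 x) i‖ ^ 2} = {U | U.1 x ∈ B.repr ⁻¹' S} := by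
    ext U
    have hU : ‖U.1 x‖ = ‖x‖ := (Unitary.linearIsometryEquiv U).norm_map x
    simp only [S, mem_ofPred_eq, mem_preimage, LinearIsometryEquiv.norm_map, hU]
  have hmass := haarUnitary_apply_mem_mul_measure_univ measurePreserving_gaussianMeasure
    (B.repr.continuous.measurable hS) hcone hx
  rw [(measurePreserving_gaussianMeasure B.repr).measure_preimage hS.nullMeasurableSet] at hmass
  have hle := hmass.trans_le (gaussianMeasure_card_div_mul_sq_norm_le_sum_le s hδ hs)
  rw [hevent]
  refine (ENNReal.mul_le_mul_iff_left ?_ ?_).1 hle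
  · rw [gaussianMeasure_univ, Ne, ENNReal.ofReal_eq_zero, not_le]
    positivity
  · rw [gaussianMeasure_univ]
    exact ENNReal.ofReal_ne_top

end Concentration

section PartialTrace

variable {ι a b : Type*} [Fintype ι] [Fintype a] [Fintype b]

theorem conjIsometry_pureState (U : EuclideanSpace ℂ ι →ₗᵢ[ℂ] EuclideanSpace ℂ a)
    (ψ : EuclideanSpace ℂ ι) : conjIsometry U (pureState ψ) = pureState (U ψ) := by
  ext1 x
  simp [conjIsometry, pureState, ContinuousLinearMap.adjoint_inner_right]

/-- The partial inner product `φ ↦ ⟨y|φ⟩_B` of a vector `y` of `ℂ^a ⊗ ℂ^b` with the vectors of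
`ℂ^b`. The result is a bra over `ℂ^a`, represented by its coordinates, so that the map is linear
in `φ` and antilinear in `y`. -/
noncomputable def partialInner (y : EuclideanSpace ℂ (a × b)) :
    EuclideanSpace ℂ b →L[ℂ] EuclideanSpace ℂ a :=
  LinearMap.toContinuousLinearMap
    { toFun := fun φ => WithLp.toLp 2 fun i => ∑ j, star (y (i, j)) * φ j
      map_add' := fun φ χ => by ext; simp [mul_add, Finset.sum_add_distrib]
      map_smul' := fun c φ => by ext; simp [Finset.mul_sum, mul_left_comm] }

theorem partialInner_apply (y : EuclideanSpace ℂ (a × b)) (φ : EuclideanSpace ℂ b) (i : a) :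
    partialInner y φ i = ∑ j, star (y (i, j)) * φ j := rfl

theorem partialInner_sub (y z : EuclideanSpace ℂ (a × b)) :
    partialInner (y - z) = partialInner y - partialInner z := by
  ext φ i
  simp [partialInner_apply, sub_mul]

theorem norm_partialTraceA_pureState [DecidableEq a] [DecidableEq b]
    (y : EuclideanSpace ℂ (a × b)) :
    ‖partialTraceA (pureState y)‖ = ‖partialInner y‖ ^ 2 := by
  have hentry : ∀ j j' : b, partialTraceA (pureState y) (EuclideanSpace.single j' 1) j
      = ⟪partialInner y (EuclideanSpace.single j 1),
          partialInner y (EuclideanSpace.single j' 1)⟫_ℂ := fun j j' => by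
    simp [partialTraceA, pureState, PiLp.inner_apply, partialInner_apply, mul_comm]
  have hadj : partialTraceA (pureState y)
      = ContinuousLinearMap.adjoint (partialInner y) ∘L partialInner y := by
    refine ContinuousLinearMap.coe_injective <|
      (EuclideanSpace.basisFun b ℂ).toBasis.ext fun j' => ?_
    ext j
    simpa [EuclideanSpace.inner_single_left] using (hentry j j').trans
      (ContinuousLinearMap.adjoint_inner_right (partialInner y) _ _).symm
  rw [hadj, ContinuousLinearMap.norm_adjoint_comp_self, sq]

theorem exists_orthonormalBasis_sq_norm_partialInner {φ : EuclideanSpace ℂ b} (hφ : ‖φ‖ = 1)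
    (j₀ : b) : ∃ B : OrthonormalBasis (a × b) ℂ (EuclideanSpace ℂ (a × b)),
      ∀ y, ‖partialInner y φ‖ ^ 2 = ∑ i, ‖B.repr y (i, j₀)‖ ^ 2 := by
  classical
  let v : a × b → EuclideanSpace ℂ (a × b) := fun p =>
    WithLp.toLp 2 fun r => if r.1 = p.1 then φ r.2 else 0
  have hinner : ∀ p y, ⟪v p, y⟫_ℂ = star (partialInner y φ p.1) := fun p y => by
    simp [v, PiLp.inner_apply, partialInner_apply, Fintype.sum_prod_type, apply_ite,
      Finset.sum_ite_irrel]
  have hon : Orthonormal ℂ ({p | p.2 = j₀}.domRestrict v) := by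
    rw [orthonormal_iff_ite]
    rintro ⟨⟨i, j⟩, hj : j = j₀⟩ ⟨⟨i', j'⟩, hj' : j' = j₀⟩
    subst hj hj'
    have hnorm : ∑ j, φ j * star (φ j) = 1 :=
      (inner_self_eq_norm_sq_to_K (𝕜 := ℂ) φ).trans (by simp [hφ])
    rw [domRestrict_apply, domRestrict_apply, hinner, partialInner_apply]
    by_cases hi : i = i'
    · simpa [v, hi] using hnorm
    · simp [v, hi]
  obtain ⟨B, hB⟩ := hon.exists_orthonormalBasis_extension_of_card_eq (by simp)
  refine ⟨B, fun y => ?_⟩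
  rw [EuclideanSpace.norm_sq_eq]
  refine Finset.sum_congr rfl fun i _ => ?_
  rw [B.repr_apply_apply, hB (i, j₀) rfl, hinner, norm_star]

theorem norm_partialInner_le (y : EuclideanSpace ℂ (a × b)) : ‖partialInner y‖ ≤ ‖y‖ := by
  refine ContinuousLinearMap.opNorm_le_of_unit_norm (norm_nonneg y) fun φ hφ => ?_
  obtain ⟨j₀⟩ : Nonempty b := not_isEmpty_iff.1 fun _ => by simp [Subsingleton.elim φ 0] at hφ
  obtain ⟨B, hB⟩ := exists_orthonormalBasis_sq_norm_partialInner (a := a) hφ j₀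
  refine le_of_sq_le_sq ?_ (norm_nonneg y)
  rw [hB, ← B.repr.norm_map y, EuclideanSpace.norm_sq_eq, Fintype.sum_prod_type]
  exact Finset.sum_le_sum fun i _ =>
    Finset.single_le_sum (f := fun j => ‖B.repr y (i, j)‖ ^ 2) (fun _ _ => sq_nonneg _)
      (Finset.mem_univ j₀)

theorem haarUnitary_le_sq_norm_partialInner_le {δ : ℝ} (hδ : 0 ≤ δ) (hb : 1 + δ < Fintype.card b)
    {φ : EuclideanSpace ℂ b} (hφ : ‖φ‖ = 1) {x : EuclideanSpace ℂ (a × b)} (hx : x ≠ 0) :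
    haarUnitary (EuclideanSpace ℂ (a × b))
        {U | (1 + δ) / Fintype.card b * ‖x‖ ^ 2 ≤ ‖partialInner (U.1 x) φ‖ ^ 2}
      ≤ ENNReal.ofReal (((1 + δ) * Real.exp (-δ)) ^ Fintype.card a) := by
  obtain ⟨i₀, j₀⟩ : Nonempty (a × b) := not_isEmpty_iff.1 fun _ => hx (Subsingleton.elim x 0)
  have ha : (0 : ℝ) < Fintype.card a := Nat.cast_pos.2 (Fintype.card_pos_iff.2 ⟨i₀⟩)
  obtain ⟨B, hB⟩ := exists_orthonormalBasis_sq_norm_partialInner (a := a) hφ j₀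
  let s : Finset (a × b) := Finset.univ ×ˢ {j₀}
  have hs : s.card = Fintype.card a := by simp [s]
  have hfrac : (1 + δ) / Fintype.card b = (1 + δ) * (s.card / Fintype.card (a × b) : ℝ) := by
    rw [hs, Fintype.card_prod, Nat.cast_mul, div_mul_cancel_left₀ ha.ne', div_eq_mul_inv]
  have hlt : (1 + δ) * s.card < Fintype.card (a × b) := by
    rw [hs, Fintype.card_prod, Nat.cast_mul, mul_comm (Fintype.card a : ℝ)]
    gcongr
  simp_rw [hB, hfrac, ← hs]
  simpa [s, Finset.sum_product] using haarUnitary_mul_sq_norm_le_sum_le s hδ hlt B hx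

end PartialTrace

section Nets

open Metric

variable {E : Type*} [NormedAddCommGroup E] [NormedSpace ℝ E] [FiniteDimensional ℝ E]

theorem card_le_of_isSeparated {η : ℝ≥0} (hη : 0 < η) {R : ℝ} (hR : 0 ≤ R) {N : Finset E}
    (hN : (N : Set E) ⊆ closedBall 0 R) (hsep : IsSeparated η (N : Set E)) :
    (N.card : ℝ) ≤ (1 + 2 * R / η) ^ finrank ℝ E := by
  borelize E
  let μ : Measure E := Measure.addHaar
  have hη' : (0 : ℝ) < η / 2 := half_pos hη
  have hdisj : (N : Set E).PairwiseDisjoint fun y => ball y (η / 2 : ℝ) := fun y hy z hz hyz =>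
    ball_disjoint_ball <| by
      have : (η : ℝ≥0∞) < edist y z := hsep hy hz hyz
      rw [edist_nndist, ENNReal.coe_lt_coe, ← NNReal.coe_lt_coe, coe_nndist] at this
      linarith
  have hsub : ⋃ y ∈ N, ball y (η / 2 : ℝ) ⊆ ball 0 (η / 2 + R) := iUnion₂_subset fun y hy =>
    ball_subset_ball' (by gcongr; exact hN hy)
  have hvol : N.card * ENNReal.ofReal ((η / 2) ^ finrank ℝ E) * μ (ball 0 1)
      ≤ ENNReal.ofReal ((η / 2 + R) ^ finrank ℝ E) * μ (ball 0 1) := by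
    calc _ = ∑ y ∈ N, μ (ball y (η / 2 : ℝ)) := by
          simp only [μ.addHaar_ball_of_pos _ hη', Finset.sum_const, nsmul_eq_mul, mul_assoc]
      _ = μ (⋃ y ∈ N, ball y (η / 2 : ℝ)) :=
          (measure_biUnion_finset hdisj fun _ _ => measurableSet_ball).symm
      _ ≤ μ (ball 0 (η / 2 + R)) := measure_mono hsub
      _ = _ := μ.addHaar_ball_of_pos _ (by positivity)
  have hcard := ENNReal.toReal_le_of_le_ofReal (by positivity)
    ((ENNReal.mul_le_mul_iff_left (measure_ball_pos _ _ one_pos).ne' measure_ball_lt_top.ne).1 hvol)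
  rw [ENNReal.toReal_mul, ENNReal.toReal_natCast, ENNReal.toReal_ofReal (by positivity),
    ← le_div_iff₀ (by positivity), ← div_pow] at hcard
  exact hcard.trans_eq (congrArg (· ^ _) (by field_simp))

theorem exists_finset_isCover_card_le {η : ℝ≥0} (hη : 0 < η) {R : ℝ} (hR : 0 ≤ R) {A : Set E}
    (hA : A ⊆ closedBall 0 R) :
    ∃ N : Finset E, (N : Set E) ⊆ A ∧ IsCover η A (N : Set E) ∧
      (N.card : ℝ) ≤ (1 + 2 * R / η) ^ finrank ℝ E := by
  have hfin : packingNumber η A ≠ ⊤ := by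
    obtain ⟨C, -, hC, hcov⟩ := exists_finite_isCover_of_isCompact_closure (half_pos hη).ne'
      ((isCompact_closedBall (0 : E) R).closure_of_subset hA)
    rw [← mul_div_cancel₀ η (two_ne_zero' ℝ≥0)]
    exact ((packingNumber_two_mul_le_externalCoveringNumber _ A).trans
      hcov.externalCoveringNumber_le_encard |>.trans_lt hC.encard_lt_top).ne
  obtain ⟨N, hN⟩ :=
    (encard_ne_top_iff.1 (encard_maximalSeparatedSet hfin ▸ hfin)).exists_finset_coe
  have hNA : (N : Set E) ⊆ A := hN ▸ maximalSeparatedSet_subset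
  exact ⟨N, hNA, hN ▸ isCover_maximalSeparatedSet hfin,
    card_le_of_isSeparated hη hR (hNA.trans hA) (hN ▸ isSeparated_maximalSeparatedSet)⟩

end Nets

section OperatorNorm

open Metric

variable {𝕜 E F : Type*} [NontriviallyNormedField 𝕜] [NormedAlgebra ℝ 𝕜]
  [NormedAddCommGroup E] [NormedSpace 𝕜 E] [NormedAddCommGroup F] [NormedSpace 𝕜 F]

theorem opNorm_le_of_isCover_sphere {η : ℝ≥0} (hη : η < 1) {N : Set E}
    (hN : IsCover η (sphere 0 1) N) (T : E →L[𝕜] F) {s : ℝ} (hs : 0 ≤ s)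
    (hT : ∀ y ∈ N, ‖T y‖ ≤ s) : ‖T‖ ≤ s / (1 - η) := by
  have hη' : (0 : ℝ) < 1 - η := sub_pos.2 hη
  suffices ‖T‖ ≤ s + ‖T‖ * η by
    rw [le_div_iff₀ hη']
    linarith
  refine ContinuousLinearMap.opNorm_le_of_unit_norm (by positivity) fun x hx => ?_
  obtain ⟨y, hy, hxy⟩ := hN (mem_sphere_zero_iff_norm.2 hx)
  have hxy' : ‖x - y‖ ≤ η := by
    simpa only [mem_ofPred_eq, edist_nndist, ENNReal.coe_le_coe, ← NNReal.coe_le_coe,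
      coe_nndist, dist_eq_norm] using hxy
  calc ‖T x‖ = ‖T y + T (x - y)‖ := by rw [← map_add, add_sub_cancel]
    _ ≤ ‖T y‖ + ‖T (x - y)‖ := norm_add_le _ _
    _ ≤ s + ‖T‖ * η := add_le_add (hT y hy) (T.le_opNorm_of_le hxy')

end OperatorNorm

section FirstMoment

variable {Ω κ : Type*} [MeasurableSpace Ω] (P : Measure Ω) [IsProbabilityMeasure P]

theorem exists_sum_prod_le_pow_mul_card (T : Finset κ) {w : κ → Ω → ℝ≥0∞} {C : ℝ≥0∞}
    (hw : ∀ j ∈ T, Measurable (w j)) (hC : ∀ j ∈ T, ∫⁻ ω, w j ω ∂P ≤ C) (n : ℕ) :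
    ∃ ω : Fin n → Ω, ∑ j ∈ T, ∏ k, w j (ω k) ≤ C ^ n * T.card := by
  induction n with
  | zero => exact ⟨Fin.elim0, by simp⟩
  | succ n ih =>
    obtain ⟨ω, hω⟩ := ih
    obtain ⟨ω₀, hω₀⟩ := exists_le_lintegral (μ := P)
      (f := fun x => ∑ j ∈ T, w j x * ∏ k, w j (ω k))
      (Finset.measurable_fun_sum _ fun j hj => (hw j hj).mul_const _).aemeasurable
    refine ⟨Fin.cons ω₀ ω, ?_⟩
    simp only [Fin.prod_univ_succ, Fin.cons_zero, Fin.cons_succ]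
    calc _ ≤ ∫⁻ x, ∑ j ∈ T, w j x * ∏ k, w j (ω k) ∂P := hω₀
      _ = ∑ j ∈ T, (∫⁻ x, w j x ∂P) * ∏ k, w j (ω k) := by
        rw [lintegral_finsetSum' _ fun j hj => ((hw j hj).mul_const _).aemeasurable]
        exact Finset.sum_congr rfl fun j hj => lintegral_mul_const _ (hw j hj)
      _ ≤ ∑ j ∈ T, C * ∏ k, w j (ω k) :=
        Finset.sum_le_sum fun j hj => mul_le_mul_left (hC j hj) _
      _ ≤ C * (C ^ n * T.card) := by
        rw [← Finset.mul_sum]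
        gcongr
      _ = C ^ (n + 1) * T.card := by ring

theorem exists_forall_pow_ncard_le (T : Finset κ) {A : κ → Set Ω} {M : ℕ}
    (hA : ∀ j ∈ T, MeasurableSet (A j)) (hM : ∀ j ∈ T, M * P (A j) ≤ 1) (n : ℕ) :
    ∃ ω : Fin n → Ω, ∀ j ∈ T, M ^ {k | ω k ∈ A j}.ncard ≤ 2 ^ n * T.card := by
  classical
  let w : κ → Ω → ℝ≥0∞ := fun j x => 1 + (A j).indicator (fun _ => (M : ℝ≥0∞)) x
  have hw : ∀ j ∈ T, ∫⁻ x, w j x ∂P ≤ 2 := fun j hj => by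
    rw [lintegral_add_left measurable_const, lintegral_indicator_const (hA j hj),
      lintegral_one, measure_univ, ← one_add_one_eq_two]
    gcongr
    exact hM j hj
  obtain ⟨ω, hω⟩ := exists_sum_prod_le_pow_mul_card P T (w := w)
    (fun j hj => (measurable_const.indicator (hA j hj)).const_add 1) hw n
  refine ⟨ω, fun j hj => ?_⟩
  have hpow : (M : ℝ≥0∞) ^ {k | ω k ∈ A j}.ncard ≤ ∏ k, w j (ω k) := by
    rw [ncard_eq_toFinset_card', toFinset_ofPred, ← Finset.prod_const, Finset.prod_filter]
    refine Finset.prod_le_prod' fun k _ => ?_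
    by_cases hk : ω k ∈ A j <;> simp [w, hk]
  exact_mod_cast hpow.trans
    ((Finset.single_le_sum (f := fun j => ∏ k, w j (ω k)) (fun _ _ => zero_le) hj).trans hω)

end FirstMoment

section RandomIsometries

open Metric

variable {ι a b : Type*} [Fintype ι] [Fintype a] [Fintype b]

theorem lipschitzWith_norm_partialInner :
    LipschitzWith 1 fun y : EuclideanSpace ℂ (a × b) => ‖partialInner y‖ :=
  LipschitzWith.of_le_add fun y z => by
    rw [dist_eq_norm]
    calc ‖partialInner y‖ = ‖partialInner z + partialInner (y - z)‖ := by
          rw [partialInner_sub, add_sub_cancel]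
      _ ≤ ‖partialInner z‖ + ‖y - z‖ :=
          (norm_add_le _ _).trans (by gcongr; exact norm_partialInner_le _)

theorem haarUnitary_lt_norm_partialInner_le {δ : ℝ} (hδ : 0 ≤ δ) (hb : 1 + δ < Fintype.card b)
    {η : ℝ≥0} (hη : 0 < η) (hη1 : η < 1) {x : EuclideanSpace ℂ (a × b)} (hx : ‖x‖ = 1) :
    haarUnitary (EuclideanSpace ℂ (a × b))
        {U | √((1 + δ) / Fintype.card b) / (1 - η) < ‖partialInner (U.1 x)‖}
      ≤ ENNReal.ofReal ((1 + 2 / η) ^ (2 * Fintype.card b) *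
          ((1 + δ) * Real.exp (-δ)) ^ Fintype.card a) := by
  obtain ⟨N, hN1, hNcov, hNcard⟩ := exists_finset_isCover_card_le hη zero_le_one
    (sphere_subset_closedBall (x := (0 : EuclideanSpace ℂ b)))
  have hN : (N.card : ℝ) ≤ (1 + 2 / η) ^ (2 * Fintype.card b) := by
    simpa [finrank_real_of_complex] using hNcard
  set p := ((1 + δ) * Real.exp (-δ)) ^ Fintype.card a
  have : 0 ≤ p := by positivity
  let bad (φ : EuclideanSpace ℂ b) :
      Set (unitary (EuclideanSpace ℂ (a × b) →L[ℂ] EuclideanSpace ℂ (a × b))) :=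
    {U | (1 + δ) / Fintype.card b * ‖x‖ ^ 2 ≤ ‖partialInner (U.1 x) φ‖ ^ 2}
  have hcover : {U | √((1 + δ) / Fintype.card b) / (1 - η) < ‖partialInner (U.1 x)‖}
      ⊆ ⋃ φ ∈ N, bad φ := fun U hU => by
    by_contra hgood
    simp only [bad, mem_iUnion, mem_ofPred_eq, not_exists, not_le, hx, one_pow, mul_one] at hgood
    exact hU.not_ge <| opNorm_le_of_isCover_sphere hη1 hNcov _ (Real.sqrt_nonneg _)
      fun φ hφ => Real.le_sqrt_of_sq_le (hgood φ hφ).le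
  calc _ ≤ ∑ φ ∈ N, haarUnitary (EuclideanSpace ℂ (a × b)) (bad φ) :=
        (measure_mono hcover).trans (measure_biUnion_finset_le _ _)
    _ ≤ N.card * ENNReal.ofReal p := by
        rw [← nsmul_eq_mul]
        exact Finset.sum_le_card_nsmul _ _ _ fun φ hφ =>
          haarUnitary_le_sq_norm_partialInner_le hδ hb (mem_sphere_zero_iff_norm.1 (hN1 hφ))
            (norm_ne_zero_iff.1 (hx ▸ one_ne_zero))
    _ ≤ _ := by
        rw [← ENNReal.ofReal_natCast, ← ENNReal.ofReal_mul (Nat.cast_nonneg _)]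
        gcongr

theorem exists_unitary_forall_pow_ncard_le {δ : ℝ} (hδ : 0 ≤ δ) (hb : 1 + δ < Fintype.card b)
    {η : ℝ≥0} (hη : 0 < η) (hη1 : η < 1) {M : ℕ}
    (hM : M * ((1 + 2 / η) ^ (2 * Fintype.card b) *
      ((1 + δ) * Real.exp (-δ)) ^ Fintype.card a) ≤ 1)
    {κ : Type*} (T : Finset κ) {x : κ → EuclideanSpace ℂ (a × b)} (hx : ∀ j ∈ T, ‖x j‖ = 1)
    (n : ℕ) :
    ∃ V : Fin n → unitary (EuclideanSpace ℂ (a × b) →L[ℂ] EuclideanSpace ℂ (a × b)),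
      ∀ j ∈ T, M ^ {k | √((1 + δ) / Fintype.card b) / (1 - η)
        < ‖partialInner ((V k).1 (x j))‖}.ncard ≤ 2 ^ n * T.card := by
  refine exists_forall_pow_ncard_le (haarUnitary (EuclideanSpace ℂ (a × b))) T
    (A := fun j => {V | _ < ‖partialInner (V.1 (x j))‖}) (fun j _ => ?_) (fun j hj => ?_) n
  · exact (isOpen_lt continuous_const (lipschitzWith_norm_partialInner.continuous.comp
      (continuous_unitary_apply.comp (.prodMk_left (x j))))).measurableSet
  · calc _ ≤ (M : ℝ≥0∞) * ENNReal.ofReal _ := by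
          gcongr
          exact haarUnitary_lt_norm_partialInner_le hδ hb hη hη1 (hx j hj)
      _ ≤ 1 := by
          rw [← ENNReal.ofReal_natCast, ← ENNReal.ofReal_mul (Nat.cast_nonneg _)]
          exact ENNReal.ofReal_le_one.2 hM

theorem exists_linearIsometry_forall_pow_ncard_le [DecidableEq a] [DecidableEq b]
    {δ : ℝ} (hδ : 0 ≤ δ) (hb : 1 + δ < Fintype.card b)
    {η η' : ℝ≥0} (hη : 0 < η) (hη1 : η < 1) (hη' : 0 < η')
    (J : EuclideanSpace ℂ ι →ₗᵢ[ℂ] EuclideanSpace ℂ (a × b)) {M : ℕ} (hM0 : 0 < M)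
    (hM : M * ((1 + 2 / η) ^ (2 * Fintype.card b) *
      ((1 + δ) * Real.exp (-δ)) ^ Fintype.card a) ≤ 1) (n : ℕ) :
    ∃ U : Fin n → (EuclideanSpace ℂ ι →ₗᵢ[ℂ] EuclideanSpace ℂ (a × b)), ∀ ψ, ‖ψ‖ = 1 →
      (M : ℝ) ^ {k | (√((1 + δ) / Fintype.card b) / (1 - η) + η') ^ 2
          < ‖partialTraceA (conjIsometry (U k) (pureState ψ))‖}.ncard
        ≤ 2 ^ n * (1 + 2 / η') ^ (2 * Fintype.card ι) := by
  obtain ⟨N, hN1, hNcov, hNcard⟩ := exists_finset_isCover_card_le hη' zero_le_one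
    (sphere_subset_closedBall (x := (0 : EuclideanSpace ℂ ι)))
  obtain ⟨V, hV⟩ := exists_unitary_forall_pow_ncard_le hδ hb hη hη1 hM N (x := J)
    (fun χ hχ => (J.norm_map χ).trans (mem_sphere_zero_iff_norm.1 (hN1 hχ))) n
  let U (k : Fin n) := (Unitary.linearIsometryEquiv (V k)).toLinearIsometry.comp J
  refine ⟨U, fun ψ hψ => ?_⟩
  obtain ⟨χ, hχ, hψχ⟩ := hNcov (mem_sphere_zero_iff_norm.2 hψ)
  have hdist (k : Fin n) : dist (U k ψ) (U k χ) ≤ η' := by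
    simpa only [mem_ofPred_eq, edist_nndist, ENNReal.coe_le_coe, ← NNReal.coe_le_coe,
      coe_nndist, LinearIsometry.dist_map] using hψχ
  set s : ℝ := √((1 + δ) / Fintype.card b) / (1 - η)
  have hsub : {k | (s + η') ^ 2 < ‖partialTraceA (conjIsometry (U k) (pureState ψ))‖}
      ⊆ {k | s < ‖partialInner (U k χ)‖} := fun k hk => by
    rw [mem_ofPred_eq, conjIsometry_pureState, norm_partialTraceA_pureState] at hk
    have hlt := lt_of_pow_lt_pow_left₀ 2 (norm_nonneg _) hk
    have hle := lipschitzWith_norm_partialInner.le_add_mul (U k ψ) (U k χ)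
    rw [NNReal.coe_one, one_mul] at hle
    rw [mem_ofPred_eq]
    linarith [hdist k]
  calc _ ≤ (M : ℝ) ^ {k | s < ‖partialInner (U k χ)‖}.ncard :=
        pow_le_pow_right₀ (Nat.one_le_cast.2 hM0) (ncard_le_ncard hsub (toFinite _))
    _ ≤ 2 ^ n * N.card := by exact_mod_cast hV χ hχ
    _ ≤ _ := by
        gcongr
        simpa [finrank_real_of_complex] using hNcard

end RandomIsometries

section Estimates

theorem one_add_mul_exp_neg_le {δ : ℝ} (h0 : 0 ≤ δ) (h1 : δ ≤ 1 / 2) :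
    (1 + δ) * Real.exp (-δ) ≤ Real.exp (-(δ ^ 2 / 3)) := by
  have hexp : 1 + δ ≤ Real.exp (δ - δ ^ 2 / 3) := by
    refine le_trans ?_ (Real.quadratic_le_exp_of_nonneg (by nlinarith))
    have : 0 ≤ δ ^ 2 * ((1 - δ / 3) ^ 2 / 2 - 1 / 3) := mul_nonneg (sq_nonneg _) (by nlinarith)
    linarith
  calc (1 + δ) * Real.exp (-δ) ≤ Real.exp (δ - δ ^ 2 / 3) * Real.exp (-δ) := by gcongr
    _ = Real.exp (-(δ ^ 2 / 3)) := by rw [← Real.exp_add]; ring_nf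

theorem sq_sqrt_div_add_lt {ε d : ℝ} (hε0 : 0 < ε) (hε1 : ε ≤ 1) (hd : 1 ≤ d) :
    (√((1 + ε / 2) / d) / (1 - ε / 20) + ε / (20 * d)) ^ 2 < (1 + ε) / d := by
  set q := (1 + ε / 2) / d with hq
  have hsmall : ε / (20 * d) ≤ √q * (ε / 20) := by
    have : 1 / d ≤ √q := Real.le_sqrt_of_sq_le <| by
      rw [hq, div_pow, div_le_div_iff₀ (by positivity) (by positivity)]
      nlinarith
    calc ε / (20 * d) = 1 / d * (ε / 20) := by field_simp
      _ ≤ √q * (ε / 20) := by gcongr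
  have hlarge : √q / (1 - ε / 20) ≤ √q * (1 + ε / 19) := by
    rw [div_le_iff₀ (by linarith), mul_assoc]
    exact le_mul_of_one_le_right (Real.sqrt_nonneg q) (by nlinarith)
  calc _ ≤ (√q * (1 + ε / 9)) ^ 2 := by
        have : 0 < 1 - ε / 20 := by linarith
        gcongr
        nlinarith [mul_nonneg (Real.sqrt_nonneg q) hε0.le]
    _ = (1 + ε / 2) * (1 + ε / 9) ^ 2 / d := by
        rw [mul_pow, Real.sq_sqrt (by positivity), hq]
        ring
    _ < (1 + ε) / d := by
        gcongr
        nlinarith [mul_pos hε0 hε0, mul_nonneg (mul_pos hε0 hε0).le (sub_nonneg.2 hε1)]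

theorem one_le_log_of_ten_le {x : ℝ} (hx : 10 ≤ x) : 1 ≤ Real.log x := by
  rw [Real.le_log_iff_exp_le (by linarith)]
  linarith [Real.exp_one_lt_d9]

theorem mul_log_two_div_mul_logb_two (x y z : ℝ) :
    x * Real.log 2 / y * (z * Real.logb 2 z) = x / y * (z * Real.log z) := by
  have : Real.log 2 ≠ 0 := (Real.log_pos one_lt_two).ne'
  rw [Real.logb]
  field_simp

theorem le_of_div_pow_mul_log_le {C ε x y : ℝ} (hC : 2 ≤ C) (hε0 : 0 < ε) (hε1 : ε ≤ 1)
    (hx : 10 ≤ x) {j : ℕ} (h : C / ε ^ j * (x * Real.log x) ≤ y + 1) : x ≤ y := by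
  have hC' : 2 ≤ C / ε ^ j :=
    hC.trans (le_div_self (by linarith) (by positivity) (pow_le_one₀ hε0.le hε1))
  have hlog : x ≤ x * Real.log x := le_mul_of_one_le_right (by linarith) (one_le_log_of_ten_le hx)
  have := mul_le_mul hC' hlog (by linarith) (by linarith)
  linarith

variable {ε : ℝ} {d : ℕ}

theorem pow_mul_net_card_mul_pow_le_one {m : ℕ} (hε0 : 0 < ε) (hε1 : ε ≤ 1)
    (hd10 : (10 : ℝ) ≤ d) (hd : 10 / ε ≤ d)
    (hm : 112 / ε ^ 2 * (d * Real.log d) ≤ m + 1) :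
    (d : ℝ) ^ (2 * d) * ((1 + 2 / (ε / 20)) ^ (2 * d) * ((1 + ε / 2) * Real.exp (-(ε / 2))) ^ m)
      ≤ 1 := by
  have hlog := one_le_log_of_ten_le hd10
  have hnet : 1 + 2 / (ε / 20) ≤ (d : ℝ) ^ 2 := by
    calc 1 + 2 / (ε / 20) = 1 + 4 * (10 / ε) := by field_simp; norm_num
      _ ≤ 1 + 4 * d := by gcongr
      _ ≤ (d : ℝ) ^ 2 := by nlinarith
  have hm' : 112 * (d * Real.log d) - ε ^ 2 ≤ m * ε ^ 2 := by
    rw [div_mul_eq_mul_div, div_le_iff₀ (by positivity)] at hm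
    linarith
  calc _ ≤ (d : ℝ) ^ (2 * d) * (((d : ℝ) ^ 2) ^ (2 * d) * Real.exp (-((ε / 2) ^ 2 / 3)) ^ m) := by
        gcongr
        exact one_add_mul_exp_neg_le (by positivity) (by linarith)
    _ = Real.exp (6 * (d * Real.log d) - m * ε ^ 2 / 12) := by
        rw [← Real.exp_nat_mul, ← pow_mul, ← mul_assoc, ← pow_add,
          ← Real.exp_log (show 0 < (d : ℝ) ^ (2 * d + 2 * (2 * d)) by positivity), Real.log_pow,
          ← Real.exp_add]
        push_cast
        ring_nf
    _ ≤ 1 := by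
        rw [Real.exp_le_one_iff]
        nlinarith [mul_le_mul hd10 hlog zero_le_one (by positivity)]

theorem mul_log_le_of_pow_le {n m c : ℕ} (hε0 : 0 < ε) (hd10 : (10 : ℝ) ≤ d) (hd : 10 / ε ≤ d)
    (hm : m ≤ d ^ 2)
    (hc : ((d : ℝ) ^ (2 * d)) ^ c ≤ 2 ^ n * (1 + 2 / (ε / (20 * d))) ^ (2 * m)) :
    c * (2 * d * Real.log d) ≤ n * Real.log 2 + 6 * d ^ 2 * Real.log d := by
  have hnet : 1 + 2 / (ε / (20 * d)) ≤ (d : ℝ) ^ 3 := by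
    calc 1 + 2 / (ε / (20 * d)) = 1 + 4 * d * (10 / ε) := by field_simp; ring
      _ ≤ 1 + 4 * d * d := by gcongr
      _ ≤ (d : ℝ) ^ 3 := by nlinarith [mul_le_mul_of_nonneg_right hd10 (sq_nonneg (d : ℝ))]
  have hpow : ((d : ℝ) ^ (2 * d)) ^ c ≤ 2 ^ n * ((d : ℝ) ^ 3) ^ (2 * d ^ 2) :=
    hc.trans <| by
      gcongr ?_ * ?_
      calc _ ≤ ((d : ℝ) ^ 3) ^ (2 * m) := by gcongr
        _ ≤ _ := by
          gcongr
          exact one_le_pow₀ (by linarith)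
  have hlog := Real.log_le_log (by positivity) hpow
  rw [Real.log_mul (by positivity) (by positivity)] at hlog
  simp only [Real.log_pow] at hlog
  push_cast at hlog
  linarith

theorem natCast_le_mul_of_pow_le {n m c : ℕ} (hε0 : 0 < ε) (hε1 : ε ≤ 1)
    (hd10 : (10 : ℝ) ≤ d) (hd : 10 / ε ≤ d) (hm : m ≤ d ^ 2)
    (hn : 120 / ε ^ 3 * (d * Real.log d) ≤ n + 1)
    (hc : ((d : ℝ) ^ (2 * d)) ^ c ≤ 2 ^ n * (1 + 2 / (ε / (20 * d))) ^ (2 * m)) :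
    (c : ℝ) ≤ ε * n := by
  have hL := one_le_log_of_ten_le hd10
  have hlog := mul_log_le_of_pow_le hε0 hd10 hd hm hc
  set L := Real.log d
  have hεn : 119 * d ≤ ε * n := by
    have hε3 : ε ^ 3 ≤ ε := pow_le_of_le_one hε0.le hε1 three_ne_zero
    rw [div_mul_eq_mul_div, div_le_iff₀ (by positivity)] at hn
    nlinarith [mul_le_mul_of_nonneg_left hε3 (Nat.cast_nonneg (α := ℝ) n)]
  have hfirst : n * Real.log 2 ≤ ε * n * (d * L) := by
    have hεdL : 1 ≤ d * ε * L := by nlinarith [(div_le_iff₀ hε0).1 hd]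
    calc n * Real.log 2 ≤ n * (d * ε * L) := by gcongr; linarith [Real.log_two_lt_d9]
      _ = ε * n * (d * L) := by ring
  have hsecond : 6 * (d : ℝ) ^ 2 * L ≤ ε * n * (d * L) := by
    calc 6 * (d : ℝ) ^ 2 * L = 6 * d * (d * L) := by ring
      _ ≤ ε * n * (d * L) := mul_le_mul_of_nonneg_right (by linarith) (by positivity)
  refine le_of_mul_le_mul_right (a := 2 * d * L) ?_ (by positivity)
  linarith

end Estimates

theorem exists_linearIsometry_of_card_le {ι κ : Type*} [Fintype ι] [Fintype κ]
    (h : Fintype.card ι ≤ Fintype.card κ) :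
    Nonempty (EuclideanSpace ℂ ι →ₗᵢ[ℂ] EuclideanSpace ℂ κ) := by
  obtain ⟨e⟩ := Function.Embedding.nonempty_of_card_le h
  let u := EuclideanSpace.basisFun ι ℂ
  let v := EuclideanSpace.basisFun κ ℂ
  refine ⟨LinearMap.isometryOfOrthonormal (u.toBasis.constr ℂ (v ∘ e)) (v := u.toBasis)
    (by simp) ?_⟩
  have hcomp : u.toBasis.constr ℂ (v ∘ e) ∘ u.toBasis = v ∘ e :=
    funext fun i => Basis.constr_basis ..
  rw [hcomp]
  exact v.orthonormal.comp e e.injective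

theorem one_sub_le_ncard_div {α : Type*} [Fintype α] [Nonempty α] {s : Set α} {ε : ℝ}
    (hs : (sᶜ.ncard : ℝ) ≤ ε * Fintype.card α) : 1 - ε ≤ s.ncard / Fintype.card α := by
  have hsum : (s.ncard : ℝ) + sᶜ.ncard = Fintype.card α := by
    exact_mod_cast (ncard_add_ncard_compl s).trans Nat.card_eq_fintype_card
  rw [le_div_iff₀ (Nat.cast_pos.2 Fintype.card_pos)]
  linarith

theorem lemma1_general {ι a b : Type*} [Fintype ι] [Fintype a] [Fintype b] [DecidableEq a]
    [DecidableEq b] {ε : ℝ} (hε0 : 0 < ε) (hε1 : ε ≤ 1) (hb : 10 / ε ≤ Fintype.card b)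
    (hι : Fintype.card ι ≤ Fintype.card b ^ 2) {n : ℕ}
    (hn : 120 / ε ^ 3 * (Fintype.card b * Real.log (Fintype.card b)) ≤ n + 1)
    (ha : 112 / ε ^ 2 * (Fintype.card b * Real.log (Fintype.card b)) ≤ Fintype.card a + 1) :
    ∃ U : Fin n → (EuclideanSpace ℂ ι →ₗᵢ[ℂ] EuclideanSpace ℂ (a × b)),
      ∀ ψ : EuclideanSpace ℂ ι, ‖ψ‖ = 1 →
        1 - ε ≤ ({k | ‖partialTraceA (conjIsometry (U k) (pureState ψ))‖
          < (1 + ε) / Fintype.card b}.ncard : ℝ) / n := by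
  lift ε to ℝ≥0 using hε0.le
  have hε : 0 < ε := NNReal.coe_pos.1 hε0
  set d := Fintype.card b
  have hd10 : (10 : ℝ) ≤ d := (le_div_self (by norm_num) hε0 hε1).trans hb
  have hda : (d : ℝ) ≤ Fintype.card a := le_of_div_pow_mul_log_le (by norm_num) hε0 hε1 hd10 ha
  have hdn : (d : ℝ) ≤ n := le_of_div_pow_mul_log_le (by norm_num) hε0 hε1 hd10 hn
  have : NeZero n := ⟨by rintro rfl; rw [Nat.cast_zero] at hdn; linarith⟩
  have hd0 : 0 < d := Nat.cast_pos.1 (by linarith : (0 : ℝ) < d)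
  obtain ⟨J⟩ : Nonempty (EuclideanSpace ℂ ι →ₗᵢ[ℂ] EuclideanSpace ℂ (a × b)) :=
    exists_linearIsometry_of_card_le <| by
      rw [Fintype.card_prod]
      exact hι.trans (sq d ▸ Nat.mul_le_mul_right d (Nat.cast_le.1 hda))
  obtain ⟨U, hU⟩ := exists_linearIsometry_forall_pow_ncard_le (δ := ε / 2) (η := ε / 20)
    (η' := ε / (20 * d)) (M := d ^ (2 * d)) (by positivity) (by linarith) (by positivity)
    (by rw [← NNReal.coe_lt_coe]; push_cast; linarith) (by positivity) J (by positivity)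
    (by exact_mod_cast pow_mul_net_card_mul_pow_le_one hε0 hε1 hd10 hb ha) n
  refine ⟨U, fun ψ hψ => ?_⟩
  have hbad := natCast_le_mul_of_pow_le hε0 hε1 hd10 hb hι hn (by exact_mod_cast hU ψ hψ)
  have hsub : {k | ‖partialTraceA (conjIsometry (U k) (pureState ψ))‖ < (1 + (ε : ℝ)) / d}ᶜ ⊆
      {k | (√((1 + (ε : ℝ) / 2) / d) / (1 - ε / 20) + ε / (20 * d)) ^ 2 <
        ‖partialTraceA (conjIsometry (U k) (pureState ψ))‖} := fun k hk =>
    (sq_sqrt_div_add_lt hε0 hε1 (by linarith : (1 : ℝ) ≤ d)).trans_le (not_lt.1 hk)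
  have hcard := (Nat.cast_le (α := ℝ)).2 (ncard_le_ncard hsub (toFinite _))
  simpa only [Fintype.card_fin] using one_sub_le_ncard_div (α := Fin n) (hcard.trans (by
    rw [Fintype.card_fin]; push_cast at hbad; exact hbad))

theorem lemma1 (ε : ℝ) (hε0 : 0 < ε) (hε1 : ε ≤ 1) (d : ℕ) (hd : 10 / ε ≤ (d : ℝ))
    -- `n` and `dA` are the real numbers of the statement rounded, up or down, to integers
    (n dA : ℕ)
    (hn : |(n : ℝ) - 120 * Real.log 2 / ε ^ 3 * (d * Real.logb 2 d)| < 1)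
    (hdA : |(dA : ℝ) - 112 * Real.log 2 / ε ^ 2 * (d * Real.logb 2 d)| < 1) :
    ∃ U : Fin n → (EuclideanSpace ℂ (Fin (d ^ 2)) →ₗᵢ[ℂ] EuclideanSpace ℂ (Fin dA × Fin d)),
      ∀ ψ : EuclideanSpace ℂ (Fin (d ^ 2)), ‖ψ‖ = 1 →
        1 - ε ≤
          ({k : Fin n | ‖partialTraceA (conjIsometry (U k) (pureState ψ))‖ < (1 + ε) / d}.ncard : ℝ)
            / n := by
  rw [mul_log_two_div_mul_logb_two, abs_lt] at hn hdA
  simpa only [Fintype.card_fin] using lemma1_general (ι := Fin (d ^ 2)) (a := Fin dA) (b := Fin d)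
    (n := n) hε0 hε1 (by simpa) (by simp) (by simp only [Fintype.card_fin]; linarith)
    (by simp only [Fintype.card_fin]; linarith)
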